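/- Let $u,s,k_u,k_s,m$ be integers with $8\le k_u\le u$, $3\le k_s\le s$, $n=us$ and $1\le m\le n$, and let $\mathrm{SNR}=1/\sigma^2>0$. Vectors in $\mathbb{C}^{n}$ consist of $u$ blocks of size $s$, and $[N]=\{0,\dots,N-1\}$. Let $W=(n^{-1/2}e^{-2\pi\imath kl/n})_{k,l\in[n]}$, let $\mathcal B$ be a uniformly random $m$-element subset of $[n]$, and let $A=\sqrt{n/m}\,W_{\mathcal B}\in\mathbb{C}^{m\times n}$ be the randomly subsampled FFT (the rows of $\sqrt{n/m}\,W$ indexed by $\mathcal B$). Let $\mathcal A\subset[n]$ be uniformly random among the sets that meet exactly $k_u$ blocks, each of them in exactly $k_s$ positions; given $\mathcal A$, let the entries of $h$ on $\mathcal A$ be i.i.d. $\mathcal{CN}(0,1)$ and let $h$ vanish outside of $\mathcal A$. Let $z'\sim\mathcal{CN}(0,\frac{\sigma^2m}{n^2}I_n)$, with $\mathcal B$, $h$, $z'$ independent. Put $h^z=h+z'$ and $y=Ah^z$, and let $\Omega_i$ be the set of all $k_s$-element subsets of the index set of the $i$-th block. For $\epsilon>0$ let \[ \mathbb P_{\overline{\mathrm{sRIP}}}(\epsilon)=\mathbb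 P\Big(\max_{i\in[u],\,\omega\in\Omega_i}\Big|\sum_{j\in\omega}|h^z_j|^2-\sum_{j\in\omega}|(A^Hy)_j|^2\Big|>\epsilon\Big). \] (1) For every $\epsilon_0>0$ there are constants $C>0$ and $\mathrm{SNR}_0>0$, depending only on $\epsilon_0$, such that for all $\epsilon\in(0,\epsilon_0]$, all $u,s,k_u,k_s,m$ as above and all $\mathrm{SNR}\ge\mathrm{SNR}_0$ \[ \mathbb P_{\overline{\mathrm{sRIP}}}(\epsilon)\le 32u\Big(\frac{es}{k_s}\Big)^{k_s}k_s\,e^{-\frac{\epsilon^2m}{C\cdot 4k_u^4k_s^5}}+\frac{32k_s}{\sqrt2}\,\frac{\mathrm{SNR}^{-k_uk_s}}{n^{2k_s}}\Big(\frac{k_u^4k_s^5}{n^{1-3/k_u}}\Big)^{k_uk_s}+4e^{-\frac{k_uk_s}{2}}. \] (2) For every $\epsilon>0$ there are constants $K>0$ and $\mathrm{SNR}_0>0$, depending only on $\epsilon$, such that along every sequence of parameters as above with $\mathrm{SNR}\ge\mathrm{SNR}_0$, $k_uk_s\to\infty$ (hence $n\to\infty$), $k_u^4k_s^5/n^{1-3/k_u}\to0$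 and $m\ge K\,k_u^4k_s^6\log n$, one has $\mathbb P_{\overline{\mathrm{sRIP}}}(\epsilon)\to0$. -/

import Mathlib

open MeasureTheory ProbabilityTheory Filter Topology Finset
open scoped Matrix

noncomputable section

namespace HierSparse

/-- The circularly symmetric complex normal distribution `CN(0, v)`: real and imaginary parts are
independent and `N(0, v / 2)`, so that `E |x|² = v`. For `v = 0` it is the Dirac mass at `0`. -/
def cgaussian (v : ℝ) : Measure ℂ :=
  ((gaussianReal 0 (v / 2).toNNReal).prod (gaussianReal 0 (v / 2).toNNReal)).map
    Complex.measurableEquivRealProd.symm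

/-- The normalized `n × n` FFT matrix, `W k l = n^(-1/2) exp(-2πi k l / n)`. -/
def fftMatrix (n : ℕ) : Matrix (Fin n) (Fin n) ℂ :=
  Matrix.of fun k l =>
    ((1 / Real.sqrt n : ℝ) : ℂ) *
      Complex.exp (-(2 * Real.pi * Complex.I * ((k : ℕ) : ℂ) * ((l : ℕ) : ℂ) / (n : ℂ)))

/-- The subsampled FFT `A = √(n/m) W_B`, with `n = u s` and `m = |B|`. Columns are indexed by pairs
`(i, j)`: user `i`, position `j` inside the block of user `i`; the pair `(i, j)` is the coordinate
`i s + j` of the stacked vector. -/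
def subFFT (u s : ℕ) (B : Finset (Fin (u * s))) : Matrix B (Fin u × Fin s) ℂ :=
  Matrix.of fun b p =>
    ((Real.sqrt ((u * s : ℕ) / (#B : ℝ)) : ℝ) : ℂ) *
      fftMatrix (u * s) b.1 (finProdFinEquiv p)

/-- All hierarchically sparse supports with exactly `ku` active blocks and exactly `ks` entries in
every active block. -/
def hierSupports (u s ku ks : ℕ) : Finset (Finset (Fin u × Fin s)) :=
  {S | #(S.image Prod.fst) = ku ∧ ∀ i ∈ S.image Prod.fst, #{p ∈ S | p.1 = i} = ks}

/-- The law of `h` given its support `S`: independent coordinates, `CN(0, 1)` on `S` and zero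
outside of `S`. -/
def signalLaw {u s : ℕ} (S : Finset (Fin u × Fin s)) : Measure (Fin u × Fin s → ℂ) :=
  Measure.pi fun p => cgaussian (if p ∈ S then 1 else 0)

/-- The law `CN(0, (σ² m / n²) I_n)` of the noise `z'`, with `n = u s` and `σ² = 1 / SNR`. -/
def noiseLaw (u s m : ℕ) (snr : ℝ) : Measure (Fin u × Fin s → ℂ) :=
  Measure.pi fun _ => cgaussian ((1 / snr) * m / ((u * s : ℕ) : ℝ) ^ 2)

/-- The deviation event for the signal `x`: with `y = A x` and the linear estimate `A^H y`, there
are a user `i` and a set `ω` of `ks` positions in the block of `i` such that the energies of `x`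
and of `A^H y` on `ω` differ by more than `ε`. -/
def Deviates {u s : ℕ} (ks : ℕ) (ε : ℝ) (B : Finset (Fin (u * s))) (x : Fin u × Fin s → ℂ) :
    Prop :=
  ∃ i : Fin u, ∃ ω : Finset (Fin s), #ω = ks ∧
    ε < |∑ j ∈ ω, ‖x (i, j)‖ ^ 2 -
      ∑ j ∈ ω, ‖((subFFT u s B)ᴴ *ᵥ (subFFT u s B *ᵥ x)) (i, j)‖ ^ 2|

/-- The probability of the deviation event for `h + z'`, where the row set `B` is uniform among the
`m`-subsets of `[n]`, `n = u s`, the support of `h` is uniform among the hierarchically sparse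
supports, and `B`, `h`, `z'` are independent. The two uniform choices are written as averages. -/
def failProb (u s ku ks m : ℕ) (snr ε : ℝ) : ℝ :=
  (∑ B ∈ powersetCard m (univ : Finset (Fin (u * s))), ∑ S ∈ hierSupports u s ku ks,
      ((signalLaw S).prod (noiseLaw u s m snr)).real {q | Deviates ks ε B (q.1 + q.2)}) /
    ((#(powersetCard m (univ : Finset (Fin (u * s)))) : ℝ) * (#(hierSupports u s ku ks) : ℝ))

/-- The standing ranges of the parameters. -/
def Admissible (u s ku ks m : ℕ) : Prop :=
  8 ≤ ku ∧ ku ≤ u ∧ 3 ≤ ks ∧ ks ≤ s ∧ 1 ≤ m ∧ m ≤ u * s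

end HierSparse

end

/-! Write `n = us`, `k = ku ks` and `Aᴴ A = 1 + E`. The estimate of `x = h + z'` is then `x + E x`,
so everything rests on making every coordinate of `E x` small. The off-diagonal entries of `E` are
averages over `B` of nontrivial characters of `ℤ/n`, which sum to zero over `[n]`. Hoeffding's
inequality without replacement (`card_sum_gt_le`, from Maclaurin's inequality) and a union bound
make them all at most `η`, except on a fraction `4 n² exp(-m η² / 16)` of the row sets
(`card_not_coherent_le`). For such a row set the two parts of `x` are treated differently. The
signal has `k` nonzero entries and, up to probability `exp(-k)`, energy at most `4k`, so
Cauchy–Schwarz gives `|(E h)_p| ≤ 2kη`. The noise is not sparse, but `A Aᴴ = (n/m) 1` bounds the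
square sum of each row of `E` by `n/m`; hence `(E z')_p` is Gaussian of variance at most `1/n` once
`SNR ≥ 1`. A weighted AM-GM inequality turns these bounds into an energy bound
(`not_deviates_of_bounds`). Optimizing the constants yields `32 n exp(-X) + 4 exp(-k/2)` in
`failProb_le`. Part (1) follows from `n ≤ u (es/ks)^ks ks` and the nonnegativity of the middle term,
part (2) from `X ≥ 2 log n`. -/

namespace HierSparse

/-! ### Concentration for sampling without replacement -/

/-- Bernoulli's inequality in homogeneous form. -/
lemma pow_add_mul_le_add_pow {A t : ℝ} (hA : 0 ≤ A) (ht : 0 ≤ A + t) (m : ℕ) :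
    A ^ (m + 1) + (m + 1) * t * A ^ m ≤ (A + t) ^ (m + 1) := by
  induction m with
  | zero => simp
  | succ m ih =>
    have h1 := mul_le_mul_of_nonneg_left ih ht
    have h2 : 0 ≤ (m + 1) * (t ^ 2 * A ^ m) := by positivity
    rw [pow_succ (A + t) (m + 1)]
    push_cast
    calc _ ≤ (A + t) * (A ^ (m + 1) + (m + 1) * t * A ^ m) := by
          have : (A + t) * (A ^ (m + 1) + (m + 1) * t * A ^ m) =
              A ^ (m + 1 + 1) + (m + 1 + 1) * t * A ^ (m + 1) + (m + 1) * (t ^ 2 * A ^ m) := by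
            ring
          linarith
      _ ≤ _ := by linarith

/-- Maclaurin's inequality between the first and the `m`-th elementary symmetric mean. -/
lemma sum_powersetCard_prod_le {ι : Type*} [DecidableEq ι] (T : Finset ι) (y : ι → ℝ)
    (hy : ∀ i ∈ T, 0 ≤ y i) (m : ℕ) :
    ∑ B ∈ powersetCard m T, ∏ i ∈ B, y i ≤ (#T).choose m * ((∑ i ∈ T, y i) / #T) ^ m := by
  induction T using Finset.induction_on generalizing m with
  | empty =>
    cases m with
    | zero => simp
    | succ m => rw [powersetCard_eq_empty.2 (by simp)]; simp
  | insert a T ha ih =>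
    have hyT : ∀ i ∈ T, 0 ≤ y i := fun i hi => hy i (mem_insert_of_mem hi)
    have hya : 0 ≤ y a := hy a (mem_insert_self a T)
    cases m with
    | zero => simp
    | succ m =>
      have ih' := fun m => ih hyT m
      set N : ℕ := #T with hN
      set A : ℝ := (∑ i ∈ T, y i) / N with hAdef
      have hA : 0 ≤ A := div_nonneg (sum_nonneg hyT) (Nat.cast_nonneg _)
      have hsum : ∑ i ∈ T, y i = N * A := by
        rcases Nat.eq_zero_or_pos N with h0 | h0
        · have : T = ∅ := Finset.card_eq_zero.1 (hN ▸ h0)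
          simp [this, h0]
        · rw [hAdef]; field_simp
      -- With this parametrization the new element shifts the mean from `A` to exactly `A + t`,
      -- which is the form Bernoulli's inequality needs.
      obtain ⟨t, ht⟩ : ∃ t : ℝ, y a = A + (N + 1) * t :=
        ⟨(y a - A) / (N + 1), by field_simp; ring⟩
      rw [powersetCard_succ_insert ha, sum_union, sum_image, card_insert_of_notMem ha, sum_insert ha,
        hsum, ht]
      · have hq : (A + (N + 1) * t + N * A) / ((N + 1 : ℕ) : ℝ) = A + t := by
          push_cast; field_simp; ring
        have hprod : ∀ B ∈ powersetCard m T, ∏ i ∈ insert a B, y i = y a * ∏ i ∈ B, y i := by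
          intro B hB
          exact prod_insert fun h => ha ((mem_powersetCard.1 hB).1 h)
        rw [hq, sum_congr rfl hprod, ← mul_sum, ht]
        have hAt : 0 ≤ A + t := by
          rw [← hq, ← ht]
          exact div_nonneg (add_nonneg hya (mul_nonneg (Nat.cast_nonneg _) hA)) (Nat.cast_nonneg _)
        have h1 := ih' (m + 1)
        have h2 := mul_le_mul_of_nonneg_left (ih' m) hya
        rw [ht] at h2
        have h3 := mul_le_mul_of_nonneg_left (pow_add_mul_le_add_pow hA hAt m)
          (Nat.cast_nonneg (α := ℝ) ((N + 1).choose (m + 1)))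
        have h4 : ((N + 1).choose (m + 1) : ℝ) = N.choose m + N.choose (m + 1) := by
          exact_mod_cast Nat.choose_succ_succ N m
        have h5 : ((N : ℝ) + 1) * N.choose m = (N + 1).choose (m + 1) * (m + 1) := by
          exact_mod_cast Nat.add_one_mul_choose_eq N m
        refine (add_le_add h1 h2).trans (le_trans (le_of_eq ?_) h3)
        -- Pascal's rule matches the terms in `A ^ (m + 1)`, the absorption identity those in `t * A
        -- ^ m`.
        linear_combination (-A ^ (m + 1)) * h4 + t * A ^ m * h5
      · intro B hB B' hB' h
        have hB := fun h => ha ((mem_powersetCard.1 (mem_coe.1 hB)).1 h)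
        have hB' := fun h => ha ((mem_powersetCard.1 (mem_coe.1 hB')).1 h)
        rw [← erase_insert hB, ← erase_insert hB', h]
      · rw [disjoint_left]
        intro B hB hB'
        obtain ⟨B', -, rfl⟩ := mem_image.1 hB'
        exact ha ((mem_powersetCard.1 hB).1 (mem_insert_self a B'))

/-- Hoeffding's inequality for sampling without replacement. -/
lemma card_sum_gt_le {ι : Type*} [Fintype ι] [DecidableEq ι] [Nonempty ι] (f : ι → ℝ)
    (hf : ∀ i, |f i| ≤ 1) (hf0 : ∑ i, f i = 0) (m : ℕ) {δ : ℝ} (hδ : 0 ≤ δ) (hδ2 : δ ≤ 2) :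
    (#{B ∈ powersetCard m (univ : Finset ι) | m * δ < ∑ i ∈ B, f i} : ℝ) ≤
      #(powersetCard m (univ : Finset ι)) * Real.exp (-(m * δ ^ 2 / 4)) := by
  have hcard : (0 : ℝ) < Fintype.card ι := by exact_mod_cast Fintype.card_pos
  have hmac := sum_powersetCard_prod_le univ (fun i => Real.exp (δ / 2 * f i))
    (fun i _ => (Real.exp_pos _).le) m
  have havg : (∑ i, Real.exp (δ / 2 * f i)) / (#(univ : Finset ι) : ℝ) ≤
      Real.exp (δ ^ 2 / 4) := by
    rw [card_univ, div_le_iff₀ hcard]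
    -- `exp x ≤ 1 + x + x²` for `|x| ≤ 1`, which is why `δ ≤ 2` is required. At the tilt `δ / 2` the
    -- exponents combine to `-mδ²/2 + mδ²/4 = -mδ²/4`.
    have h1 : ∀ i, Real.exp (δ / 2 * f i) ≤ 1 + δ / 2 * f i + δ ^ 2 / 4 := by
      intro i
      have hb : |δ / 2 * f i| ≤ δ / 2 := by
        rw [abs_mul, abs_of_nonneg (by linarith)]
        exact mul_le_of_le_one_right (by linarith) (hf i)
      have h2 := Real.abs_exp_sub_one_sub_id_le (x := δ / 2 * f i) (by linarith)
      have h3 : (δ / 2 * f i) ^ 2 ≤ (δ / 2) ^ 2 := by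
        rw [← sq_abs]; gcongr
      have := (abs_le.1 h2).2
      nlinarith
    calc ∑ i, Real.exp (δ / 2 * f i) ≤ ∑ i, (1 + δ / 2 * f i + δ ^ 2 / 4) :=
          sum_le_sum fun i _ => h1 i
      _ = (δ ^ 2 / 4 + 1) * Fintype.card ι := by
          rw [sum_add_distrib, sum_add_distrib, ← mul_sum, hf0]
          simp; ring
      _ ≤ _ := by gcongr; exact Real.add_one_le_exp _
  have hmarkov : (#{B ∈ powersetCard m (univ : Finset ι) | m * δ < ∑ i ∈ B, f i} : ℝ) *
      Real.exp (δ / 2 * (m * δ)) ≤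
      ∑ B ∈ powersetCard m (univ : Finset ι), ∏ i ∈ B, Real.exp (δ / 2 * f i) := by
    rw [← nsmul_eq_mul]
    refine (card_nsmul_le_sum _ (fun B => ∏ i ∈ B, Real.exp (δ / 2 * f i)) _ ?_).trans
      (sum_le_sum_of_subset_of_nonneg (filter_subset _ _) fun B _ _ => by positivity)
    intro B hB
    rw [← Real.exp_sum, ← mul_sum]
    gcongr
    exact (mem_filter.1 hB).2.le
  have hpos : (0 : ℝ) ≤ (∑ i, Real.exp (δ / 2 * f i)) / (#(univ : Finset ι) : ℝ) := by positivity
  have h := hmarkov.trans (hmac.trans (mul_le_mul_of_nonneg_left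
    (pow_le_pow_left₀ hpos havg m) (Nat.cast_nonneg _)))
  rw [← le_div_iff₀ (Real.exp_pos _)] at h
  refine h.trans (le_of_eq ?_)
  rw [card_powersetCard, mul_div_assoc, ← Real.exp_nat_mul, ← Real.exp_sub]
  congr 2
  ring

/-! ### Characters and the Gram matrix of the subsampled FFT -/

/-- The character `b ↦ exp(2πi b d / n)`. -/
noncomputable def phase (n : ℕ) (d : ℤ) (b : ℕ) : ℂ :=
  Complex.exp (((2 * Real.pi * (b * d / n) : ℝ) : ℂ) * Complex.I)

lemma norm_phase (n : ℕ) (d : ℤ) (b : ℕ) : ‖phase n d b‖ = 1 :=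
  Complex.norm_exp_ofReal_mul_I _

lemma phase_zero (n b : ℕ) : phase n 0 b = 1 := by simp [phase]

lemma phase_eq_pow {n : ℕ} (d : ℤ) (b : ℕ) : phase n d b = phase n d 1 ^ b := by
  rw [phase, phase, ← Complex.exp_nat_mul]
  congr 1
  push_cast
  ring

lemma phase_one_eq_zpow (n : ℕ) (d : ℤ) :
    phase n d 1 = Complex.exp (2 * Real.pi * Complex.I / n) ^ d := by
  rw [phase, ← Complex.exp_int_mul]
  congr 1
  push_cast
  ring

lemma sum_phase {n : ℕ} (hn : n ≠ 0) {d : ℤ} (hd : ¬ (n : ℤ) ∣ d) :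
    ∑ b : Fin n, phase n d b = 0 := by
  have hprim := Complex.isPrimitiveRoot_exp n hn
  have h1 : phase n d 1 ≠ 1 := by
    rw [phase_one_eq_zpow]
    exact fun h => hd ((hprim.zpow_eq_one_iff_dvd d).1 h)
  have hpow : phase n d 1 ^ n = 1 := by
    rw [phase_one_eq_zpow, ← zpow_natCast, ← zpow_mul, mul_comm d, zpow_mul, zpow_natCast,
      hprim.pow_eq_one, one_zpow]
  rw [Fin.sum_univ_eq_sum_range (fun b => phase n d b) n, sum_congr rfl fun b _ => phase_eq_pow d b,
    geom_sum_eq h1, hpow, sub_self, zero_div]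

lemma not_dvd_sub_of_ne {n : ℕ} {a b : Fin n} (h : a ≠ b) :
    ¬ (n : ℤ) ∣ ((a : ℕ) : ℤ) - ((b : ℕ) : ℤ) := by
  intro hd
  apply h
  have := Int.eq_zero_of_abs_lt_dvd hd (by rw [abs_lt]; omega)
  ext
  omega

/-- Kept general in all four indices: `b = c` serves the entries of `Aᴴ A`, `p = q` those of `A Aᴴ`.
-/
lemma star_fftMatrix_mul (n : ℕ) (b p c q : Fin n) :
    star (fftMatrix n b p) * fftMatrix n c q =
      (1 / n : ℂ) * Complex.exp (((2 * Real.pi *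
        (((b : ℕ) : ℝ) * (p : ℕ) - ((c : ℕ) : ℝ) * (q : ℕ)) / n : ℝ) : ℂ) * Complex.I) := by
  have hs : ((1 / Real.sqrt n : ℝ) : ℂ) * ((1 / Real.sqrt n : ℝ) : ℂ) = 1 / n := by
    rw [← Complex.ofReal_mul, div_mul_div_comm, Real.mul_self_sqrt (Nat.cast_nonneg _)]
    simp
  simp only [fftMatrix, Matrix.of_apply, star_mul']
  rw [mul_mul_mul_comm]
  congr 1
  · rw [← hs]; simp
  · rw [Complex.star_def, ← Complex.exp_conj, ← Complex.exp_add]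
    congr 1
    simp only [map_neg, map_mul, map_div₀, Complex.conj_ofReal, Complex.conj_I, map_natCast]
    rw [show (starRingEnd ℂ) 2 = 2 from Complex.conj_ofNat 2]
    push_cast
    ring

variable {u s : ℕ}

/-- The Gram matrix `Aᴴ A` of the subsampled FFT. -/
noncomputable def gram (u s : ℕ) (B : Finset (Fin (u * s))) : Matrix (Fin u × Fin s) (Fin u × Fin s) ℂ :=
  (subFFT u s B)ᴴ * subFFT u s B

lemma gram_apply (hn : u * s ≠ 0) (B : Finset (Fin (u * s))) (p q : Fin u × Fin s) :
    gram u s B p q = (1 / #B : ℂ) * ∑ b ∈ B, phase (u * s)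
      ((finProdFinEquiv p : ℕ) - (finProdFinEquiv q : ℕ) : ℤ) b := by
  have hn' : ((u * s : ℕ) : ℂ) ≠ 0 := by exact_mod_cast hn
  rw [gram, Matrix.mul_apply, mul_sum, ← sum_coe_sort B]
  refine sum_congr rfl fun b _ => ?_
  have hB : (#B : ℂ) ≠ 0 := by exact_mod_cast card_ne_zero_of_mem b.2
  simp only [Matrix.conjTranspose_apply, subFFT, Matrix.of_apply, star_mul']
  rw [mul_mul_mul_comm, star_fftMatrix_mul, Complex.star_def, Complex.conj_ofReal,
    ← Complex.ofReal_mul, Real.mul_self_sqrt (by positivity), ← mul_assoc]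
  congr 1
  · push_cast at hn' ⊢
    field_simp
    exact div_self hn'
  · rw [phase]
    congr 2
    push_cast
    ring

lemma gram_diag (hn : u * s ≠ 0) {B : Finset (Fin (u * s))} (hB : #B ≠ 0) (p : Fin u × Fin s) :
    gram u s B p p = 1 := by
  have : (#B : ℂ) ≠ 0 := by exact_mod_cast hB
  rw [gram_apply hn]
  simp [phase_zero, this]

lemma subFFT_mul_conjTranspose (hn : u * s ≠ 0) (B : Finset (Fin (u * s))) :
    subFFT u s B * (subFFT u s B)ᴴ = (((u * s : ℕ) : ℂ) / #B) • (1 : Matrix B B ℂ) := by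
  have hn' : ((u * s : ℕ) : ℂ) ≠ 0 := by exact_mod_cast hn
  ext b c
  have hB : (#B : ℂ) ≠ 0 := by exact_mod_cast card_ne_zero_of_mem b.2
  rw [Matrix.mul_apply, Matrix.smul_apply, Matrix.one_apply]
  have hterm : ∀ p : Fin u × Fin s, subFFT u s B b p * (subFFT u s B)ᴴ p c =
      (1 / #B : ℂ) * phase (u * s) ((c.1 : ℕ) - (b.1 : ℕ) : ℤ) (finProdFinEquiv p : Fin (u * s)) := by
    intro p
    simp only [Matrix.conjTranspose_apply, subFFT, Matrix.of_apply, star_mul']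
    rw [mul_mul_mul_comm, mul_comm (fftMatrix _ _ _), star_fftMatrix_mul, Complex.star_def,
      Complex.conj_ofReal, ← Complex.ofReal_mul, Real.mul_self_sqrt (by positivity), ← mul_assoc]
    congr 1
    · push_cast at hn' ⊢
      field_simp
      exact div_self hn'
    · rw [phase]
      congr 2
      push_cast
      ring
  rw [sum_congr rfl fun p _ => hterm p, ← mul_sum,
    Equiv.sum_comp finProdFinEquiv fun l : Fin (u * s) => phase (u * s) _ (l : ℕ)]
  split_ifs with h
  · subst h
    simp [phase_zero]
    ring
  · rw [sum_phase hn (not_dvd_sub_of_ne fun h' => h (Subtype.ext h'.symm))]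
    simp

/-- Since `A Aᴴ = (n/m) 1`, the Hermitian matrix `G = Aᴴ A` satisfies `G Gᴴ = (n/m) G`; compare
diagonal entries, with `G p p = 1`. This controls the variance of the noise after multiplication by
a row. -/
lemma sum_norm_sq_gram (hn : u * s ≠ 0) {B : Finset (Fin (u * s))} (hB : #B ≠ 0)
    (p : Fin u × Fin s) : ∑ q, ‖gram u s B p q‖ ^ 2 = ((u * s : ℕ) : ℝ) / #B := by
  have hgg : gram u s B * (gram u s B)ᴴ = (((u * s : ℕ) : ℂ) / #B) • gram u s B := by
    rw [gram, Matrix.conjTranspose_mul, Matrix.conjTranspose_conjTranspose, Matrix.mul_assoc,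
      ← Matrix.mul_assoc (subFFT u s B), subFFT_mul_conjTranspose hn, Matrix.smul_mul,
      Matrix.one_mul, Matrix.mul_smul]
  have h := congrFun (congrFun hgg p) p
  rw [Matrix.mul_apply, Matrix.smul_apply, gram_diag hn hB, smul_eq_mul, mul_one] at h
  have h2 : ((∑ q, ‖gram u s B p q‖ ^ 2 : ℝ) : ℂ) = ((((u * s : ℕ) : ℝ) / #B : ℝ) : ℂ) := by
    push_cast
    push_cast at h
    rw [← h]
    refine sum_congr rfl fun q _ => ?_
    rw [Matrix.conjTranspose_apply, Complex.star_def, Complex.mul_conj']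
  exact_mod_cast h2

/-! ### Coherence of a random row set -/

/-- The row sets whose Gram matrix has all off-diagonal entries of modulus at most `η`. -/
def Coherent (η : ℝ) (B : Finset (Fin (u * s))) : Prop :=
  ∀ p q : Fin u × Fin s, p ≠ q → ‖gram u s B p q‖ ≤ η

lemma four_parts_of_lt_norm {z : ℂ} {r : ℝ} (hr : 2 * r < ‖z‖) :
    r < z.re ∨ r < -z.re ∨ r < z.im ∨ r < -z.im := by
  by_contra! h
  have h1 := Complex.norm_le_abs_re_add_abs_im z
  have h2 : |z.re| ≤ r := abs_le.2 ⟨by linarith [h.2.1], h.1⟩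
  have h3 : |z.im| ≤ r := abs_le.2 ⟨by linarith [h.2.2.2], h.2.2.1⟩
  linarith

lemma card_norm_sum_gt_le {ι : Type*} [Fintype ι] [DecidableEq ι] [Nonempty ι] (f : ι → ℂ)
    (hf : ∀ i, ‖f i‖ ≤ 1) (hf0 : ∑ i, f i = 0) (m : ℕ) {δ : ℝ} (hδ : 0 ≤ δ) (hδ2 : δ ≤ 2) :
    (#{B ∈ powersetCard m (univ : Finset ι) | 2 * (m * δ) < ‖∑ i ∈ B, f i‖} : ℝ) ≤
      #(powersetCard m (univ : Finset ι)) * (4 * Real.exp (-(m * δ ^ 2 / 4))) := by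
  classical
  have hre0 : ∑ i, (f i).re = 0 := by rw [← Complex.re_sum, hf0]; rfl
  have him0 : ∑ i, (f i).im = 0 := by rw [← Complex.im_sum, hf0]; rfl
  have hre : ∀ i, |(f i).re| ≤ 1 := fun i => (Complex.abs_re_le_norm _).trans (hf i)
  have him : ∀ i, |(f i).im| ≤ 1 := fun i => (Complex.abs_im_le_norm _).trans (hf i)
  have h1 := card_sum_gt_le (fun i => (f i).re) hre hre0 m hδ hδ2
  have h2 := card_sum_gt_le (fun i => -(f i).re) (by simpa using hre) (by simp [hre0]) m hδ hδ2
  have h3 := card_sum_gt_le (fun i => (f i).im) him him0 m hδ hδ2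
  have h4 := card_sum_gt_le (fun i => -(f i).im) (by simpa using him) (by simp [him0]) m hδ hδ2
  set P := powersetCard m (univ : Finset ι)
  have hsub : {B ∈ P | 2 * (m * δ) < ‖∑ i ∈ B, f i‖} ⊆
      ({B ∈ P | m * δ < ∑ i ∈ B, (f i).re} ∪ {B ∈ P | m * δ < ∑ i ∈ B, -(f i).re}) ∪
      ({B ∈ P | m * δ < ∑ i ∈ B, (f i).im} ∪ {B ∈ P | m * δ < ∑ i ∈ B, -(f i).im}) := by
    intro B hB
    obtain ⟨hBP, hB⟩ := mem_filter.1 hB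
    have := four_parts_of_lt_norm hB
    simp only [Complex.re_sum, Complex.im_sum] at this
    simp only [mem_union, mem_filter, hBP, true_and, sum_neg_distrib]
    tauto
  have hcard : (#{B ∈ P | 2 * (m * δ) < ‖∑ i ∈ B, f i‖} : ℝ) ≤
      (#{B ∈ P | m * δ < ∑ i ∈ B, (f i).re} + #{B ∈ P | m * δ < ∑ i ∈ B, -(f i).re}) +
      (#{B ∈ P | m * δ < ∑ i ∈ B, (f i).im} + #{B ∈ P | m * δ < ∑ i ∈ B, -(f i).im}) := by
    exact_mod_cast (card_le_card hsub).trans ((card_union_le _ _).trans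
      (add_le_add (card_union_le _ _) (card_union_le _ _)))
  linarith

-- Union bound over at most `n²` pairs of columns. Passing from complex to real sums costs a factor
-- 4 and halves the threshold, so Hoeffding is applied with `δ = η / 2`.
open Classical in
lemma card_not_coherent_le (hn : u * s ≠ 0) {m : ℕ} (hm : m ≠ 0) {η : ℝ} (hη : 0 ≤ η)
    (hη1 : η ≤ 1) :
    (#{B ∈ powersetCard m (univ : Finset (Fin (u * s))) | ¬ Coherent η B} : ℝ) ≤
      #(powersetCard m (univ : Finset (Fin (u * s)))) *
        (4 * ((u * s : ℕ) : ℝ) ^ 2 * Real.exp (-(m * η ^ 2 / 16))) := by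
  have : Nonempty (Fin (u * s)) := ⟨⟨0, Nat.pos_of_ne_zero hn⟩⟩
  have hm0 : (0 : ℝ) < m := by exact_mod_cast Nat.pos_of_ne_zero hm
  set P := powersetCard m (univ : Finset (Fin (u * s))) with hP
  let F (a b : Fin (u * s)) : Finset (Finset (Fin (u * s))) :=
    {B ∈ P | 2 * (m * (η / 2)) < ‖∑ i ∈ B, phase (u * s) ((a : ℕ) - (b : ℕ) : ℤ) i‖}
  have hsub : {B ∈ P | ¬ Coherent η B} ⊆
      (univ.filter fun x : Fin (u * s) × Fin (u * s) => x.1 ≠ x.2).biUnion fun x => F x.1 x.2 := by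
    intro B hB
    obtain ⟨hBP, hB⟩ := mem_filter.1 hB
    have hBm : #B = m := (mem_powersetCard.1 hBP).2
    unfold Coherent at hB
    push Not at hB
    obtain ⟨p, q, hpq, hB⟩ := hB
    rw [mem_biUnion]
    refine ⟨(finProdFinEquiv p, finProdFinEquiv q), by simpa using hpq,
      mem_filter.2 ⟨hBP, ?_⟩⟩
    rw [gram_apply hn, hBm, norm_mul, norm_div, norm_one, Complex.norm_natCast, one_div,
      inv_mul_eq_div, lt_div_iff₀ hm0] at hB
    linarith
  have hF : ∀ x ∈ univ.filter fun x : Fin (u * s) × Fin (u * s) => x.1 ≠ x.2,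
      (#(F x.1 x.2) : ℝ) ≤ #P * (4 * Real.exp (-(m * η ^ 2 / 16))) := by
    intro x hx
    have h := card_norm_sum_gt_le (fun i : Fin (u * s) =>
      phase (u * s) ((x.1 : ℕ) - (x.2 : ℕ) : ℤ) i) (fun i => (norm_phase _ _ _).le)
      (sum_phase hn (not_dvd_sub_of_ne (mem_filter.1 hx).2)) m (δ := η / 2) (by linarith)
      (by linarith)
    rwa [show (m : ℝ) * (η / 2) ^ 2 / 4 = m * η ^ 2 / 16 by ring] at h
  calc (#{B ∈ P | ¬ Coherent η B} : ℝ)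
      ≤ ∑ x ∈ univ.filter fun x : Fin (u * s) × Fin (u * s) => x.1 ≠ x.2, (#(F x.1 x.2) : ℝ) := by
        exact_mod_cast (card_le_card hsub).trans card_biUnion_le
    _ ≤ ∑ x : Fin (u * s) × Fin (u * s), #P * (4 * Real.exp (-(m * η ^ 2 / 16))) :=
        (sum_le_sum hF).trans (sum_le_sum_of_subset_of_nonneg (filter_subset _ _)
          fun _ _ _ => by positivity)
    _ = _ := by
        rw [sum_const, card_univ, Fintype.card_prod, Fintype.card_fin, nsmul_eq_mul]
        push_cast
        ring

/-! ### Tails of complex Gaussian vectors -/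

/-- Chernoff's bound for a separable statistic under a product law. -/
lemma pi_real_lt_sum_le {ι : Type*} [Fintype ι] {μ : ι → Measure ℂ}
    [∀ i, IsProbabilityMeasure (μ i)] {g : ι → ℂ → ℝ}
    (hg : ∀ i, Integrable (fun z => Real.exp (g i z)) (μ i)) (T : ℝ) :
    (Measure.pi μ).real {x | T < ∑ i, g i (x i)} ≤
      Real.exp (-T) * ∏ i, ∫ z, Real.exp (g i z) ∂μ i := by
  have h := mul_meas_ge_le_integral_of_nonneg (μ := Measure.pi μ)
    (f := fun x => ∏ i, Real.exp (g i (x i))) (Eventually.of_forall fun x => by positivity)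
    (Integrable.fintype_prod hg) (Real.exp T)
  rw [integral_fintype_prod_eq_prod (𝕜 := ℝ) (fun i z => Real.exp (g i z))] at h
  have hsub : {x : ι → ℂ | T < ∑ i, g i (x i)} ⊆
      {x | Real.exp T ≤ ∏ i, Real.exp (g i (x i))} := by
    intro x hx
    rw [Set.mem_ofPred_eq, ← Real.exp_sum]
    exact Real.exp_le_exp.2 (le_of_lt hx)
  rw [Real.exp_neg, inv_mul_eq_div, le_div_iff₀ (Real.exp_pos _), mul_comm]
  exact (mul_le_mul_of_nonneg_left (measureReal_mono hsub) (Real.exp_pos _).le).trans h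

instance (v : ℝ) : IsProbabilityMeasure (cgaussian v) :=
  Measure.isProbabilityMeasure_map Complex.measurableEquivRealProd.symm.measurable.aemeasurable

lemma cgaussian_zero : cgaussian 0 = Measure.dirac 0 := by
  rw [cgaussian, zero_div, Real.toNNReal_zero, gaussianReal_zero_var, Measure.dirac_prod_dirac,
    Measure.map_dirac]
  rfl

lemma integrable_cgaussian_of_mul {v : ℝ} {g : ℂ → ℝ} {f₁ f₂ : ℝ → ℝ}
    (hg : ∀ x y : ℝ, g ⟨x, y⟩ = f₁ x * f₂ y)
    (h₁ : Integrable f₁ (gaussianReal 0 (v / 2).toNNReal))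
    (h₂ : Integrable f₂ (gaussianReal 0 (v / 2).toNNReal)) :
    Integrable g (cgaussian v) := by
  rw [cgaussian, integrable_map_equiv]
  refine (h₁.mul_prod h₂).congr (Eventually.of_forall fun x => ?_)
  exact (hg x.1 x.2).symm

lemma integral_cgaussian_of_mul {v : ℝ} {g : ℂ → ℝ} {f₁ f₂ : ℝ → ℝ}
    (hg : ∀ x y : ℝ, g ⟨x, y⟩ = f₁ x * f₂ y) :
    ∫ z, g z ∂cgaussian v = (∫ x, f₁ x ∂gaussianReal 0 (v / 2).toNNReal) *
      ∫ x, f₂ x ∂gaussianReal 0 (v / 2).toNNReal := by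
  rw [cgaussian, integral_map_equiv, ← integral_prod_mul]
  exact integral_congr_ae (Eventually.of_forall fun x => hg x.1 x.2)

lemma exp_re_mul_mk (a : ℂ) (x y : ℝ) :
    Real.exp (a * ⟨x, y⟩ : ℂ).re = Real.exp (a.re * x) * Real.exp (-a.im * y) := by
  rw [← Real.exp_add, Complex.mul_re]
  congr 1
  ring

lemma integrable_exp_re_mul_cgaussian (v : ℝ) (a : ℂ) :
    Integrable (fun z : ℂ => Real.exp (a * z).re) (cgaussian v) :=
  integrable_cgaussian_of_mul (exp_re_mul_mk a) (integrable_exp_mul_gaussianReal _)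
    (integrable_exp_mul_gaussianReal _)

lemma integral_exp_re_mul_cgaussian {v : ℝ} (hv : 0 ≤ v) (a : ℂ) :
    ∫ z : ℂ, Real.exp (a * z).re ∂cgaussian v = Real.exp (v * ‖a‖ ^ 2 / 4) := by
  have h : ∀ t : ℝ, ∫ x, Real.exp (t * x) ∂gaussianReal 0 (v / 2).toNNReal =
      Real.exp (v * t ^ 2 / 4) := by
    intro t
    have h := congrFun (mgf_id_gaussianReal (μ := 0) (v := (v / 2).toNNReal)) t
    rw [mgf] at h
    simp only [id] at h
    rw [h, Real.coe_toNNReal _ (by positivity)]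
    congr 1
    ring
  rw [integral_cgaussian_of_mul (exp_re_mul_mk a), h, h, ← Real.exp_add, Complex.sq_norm,
    Complex.normSq_apply]
  congr 1
  ring

/-- The tilt cancels half of the exponent, leaving `√2` times the density of variance `2w`. A
complex coordinate therefore has exponential moment `√2 * √2 = 2`. -/
lemma gaussianPDFReal_mul_exp_sq {w : NNReal} (hw : w ≠ 0) (x : ℝ) :
    gaussianPDFReal 0 w x * Real.exp (x ^ 2 / (4 * w)) =
      (Real.sqrt (2 * Real.pi * w))⁻¹ * Real.exp (-(1 / (4 * w)) * x ^ 2) := by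
  have hw' : (w : ℝ) ≠ 0 := by exact_mod_cast hw
  rw [gaussianPDFReal, mul_assoc, ← Real.exp_add]
  congr 2
  field_simp
  ring

lemma integrable_exp_sq_gaussianReal {w : NNReal} (hw : w ≠ 0) :
    Integrable (fun x : ℝ => Real.exp (x ^ 2 / (4 * w))) (gaussianReal 0 w) := by
  have hw' : (0 : ℝ) < w := by exact_mod_cast pos_iff_ne_zero.2 hw
  rw [gaussianReal_of_var_ne_zero _ hw, integrable_withDensity_iff_integrable_smul'
    (measurable_gaussianPDF _ _) (ae_of_all _ fun _ => gaussianPDF_lt_top)]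
  simp only [toReal_gaussianPDF, smul_eq_mul, gaussianPDFReal_mul_exp_sq hw]
  exact (integrable_exp_neg_mul_sq (by positivity)).const_mul _

lemma integral_exp_sq_gaussianReal {w : NNReal} (hw : w ≠ 0) :
    ∫ x : ℝ, Real.exp (x ^ 2 / (4 * w)) ∂gaussianReal 0 w = Real.sqrt 2 := by
  have hw' : (0 : ℝ) < w := by exact_mod_cast pos_iff_ne_zero.2 hw
  rw [integral_gaussianReal_eq_integral_smul hw]
  simp only [smul_eq_mul, gaussianPDFReal_mul_exp_sq hw]
  rw [integral_const_mul, integral_gaussian, inv_mul_eq_div, ← Real.sqrt_div (by positivity)]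
  congr 1
  have := Real.pi_pos
  field_simp
  norm_num

lemma exp_norm_sq_mk {v : ℝ} (hv : 0 < v) (x y : ℝ) :
    Real.exp (‖(⟨x, y⟩ : ℂ)‖ ^ 2 / (2 * v)) =
      Real.exp (x ^ 2 / (4 * ((v / 2).toNNReal : ℝ))) *
        Real.exp (y ^ 2 / (4 * ((v / 2).toNNReal : ℝ))) := by
  rw [← Real.exp_add, Complex.sq_norm, Complex.normSq_mk, Real.coe_toNNReal _ (by positivity)]
  congr 1
  field_simp
  ring

lemma integrable_exp_norm_sq_cgaussian {v : ℝ} (hv : 0 < v) :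
    Integrable (fun z : ℂ => Real.exp (‖z‖ ^ 2 / (2 * v))) (cgaussian v) := by
  have hw : (v / 2).toNNReal ≠ 0 := by simpa using hv
  exact integrable_cgaussian_of_mul (exp_norm_sq_mk hv) (integrable_exp_sq_gaussianReal hw)
    (integrable_exp_sq_gaussianReal hw)

lemma integral_exp_norm_sq_cgaussian {v : ℝ} (hv : 0 < v) :
    ∫ z : ℂ, Real.exp (‖z‖ ^ 2 / (2 * v)) ∂cgaussian v = 2 := by
  have hw : (v / 2).toNNReal ≠ 0 := by simpa using hv
  rw [integral_cgaussian_of_mul (exp_norm_sq_mk hv), integral_exp_sq_gaussianReal hw,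
    Real.mul_self_sqrt (by norm_num)]

/-- Closes both energy tails: a threshold of four times the mean gives `exp(-2k)` after tilting, and
each of the `k` coordinates contributes a moment 2. -/
lemma exp_neg_two_mul_two_pow_le (k : ℕ) : Real.exp (-(2 * k)) * 2 ^ k ≤ Real.exp (-k) := by
  have h : (2 : ℝ) ≤ Real.exp 1 := by linarith [Real.add_one_le_exp (1 : ℝ)]
  calc Real.exp (-(2 * k)) * 2 ^ k ≤ Real.exp (-(2 * k)) * Real.exp 1 ^ k := by gcongr
    _ = _ := by
      rw [← Real.exp_nat_mul, ← Real.exp_add]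
      congr 1
      ring

instance (S : Finset (Fin u × Fin s)) : IsProbabilityMeasure (signalLaw S) := by
  unfold signalLaw; infer_instance

instance (m : ℕ) (snr : ℝ) : IsProbabilityMeasure (noiseLaw u s m snr) := by
  unfold noiseLaw; infer_instance

lemma signalLaw_norm_sq (S : Finset (Fin u × Fin s)) :
    (signalLaw S).real {h | 4 * (#S : ℝ) < ∑ p, ‖h p‖ ^ 2} ≤ Real.exp (-#S) := by
  have hint : ∀ p : Fin u × Fin s, Integrable (fun z : ℂ => Real.exp (‖z‖ ^ 2 / 2))
      (cgaussian (if p ∈ S then 1 else 0)) := by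
    intro p
    split_ifs
    · simpa using integrable_exp_norm_sq_cgaussian one_pos
    · rw [cgaussian_zero]
      exact integrable_dirac (by simp)
  have hval : ∀ p : Fin u × Fin s, ∫ z : ℂ, Real.exp (‖z‖ ^ 2 / 2)
      ∂cgaussian (if p ∈ S then 1 else 0) = if p ∈ S then 2 else 1 := by
    intro p
    split_ifs
    · simpa using integral_exp_norm_sq_cgaussian one_pos
    · rw [cgaussian_zero, integral_dirac]
      simp
  have h := pi_real_lt_sum_le hint (2 * #S)
  rw [prod_congr rfl fun p _ => hval p, prod_ite_mem, univ_inter, prod_const] at h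
  refine le_trans (measureReal_mono ?_) (h.trans (exp_neg_two_mul_two_pow_le _))
  intro x hx
  rw [Set.mem_ofPred_eq] at hx ⊢
  rw [← sum_div]
  linarith

lemma signalLaw_support (S : Finset (Fin u × Fin s)) :
    (signalLaw S).real {h | ∃ p ∉ S, h p ≠ 0} = 0 := by
  have hp : ∀ p ∉ S, signalLaw S {h | h p ≠ 0} = 0 := by
    intro p hp
    have h := (measurePreserving_eval (fun p : Fin u × Fin s =>
      cgaussian (if p ∈ S then 1 else 0)) p).measure_preimage
      (s := {0}ᶜ) (measurableSet_singleton 0).compl.nullMeasurableSet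
    rw [if_neg hp, cgaussian_zero] at h
    rw [signalLaw]
    refine Eq.trans ?_ (h.trans (by simp))
    rfl
  rw [measureReal_def]
  have : signalLaw S {h | ∃ p ∉ S, h p ≠ 0} = 0 := by
    have heq : {h : Fin u × Fin s → ℂ | ∃ p ∉ S, h p ≠ 0} =
        ⋃ p : {p // p ∉ S}, {h | h p.1 ≠ 0} := by
      ext h; simp
    rw [heq]
    exact measure_iUnion_null fun p => hp p.1 p.2
  rw [this, ENNReal.toReal_zero]

lemma pi_cgaussian_norm_sq {ι : Type*} [Fintype ι] {v : ℝ} (hv : 0 < v) :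
    (Measure.pi fun _ : ι => cgaussian v).real
      {z | 4 * (Fintype.card ι * v) < ∑ p, ‖z p‖ ^ 2} ≤ Real.exp (-Fintype.card ι) := by
  have h := pi_real_lt_sum_le (ι := ι) (fun _ => integrable_exp_norm_sq_cgaussian hv)
    (2 * Fintype.card ι)
  simp only [integral_exp_norm_sq_cgaussian hv, prod_const, card_univ] at h
  refine le_trans (measureReal_mono ?_) (h.trans (exp_neg_two_mul_two_pow_le _))
  intro x hx
  rw [Set.mem_ofPred_eq] at hx ⊢
  rw [← sum_div, lt_div_iff₀ (by positivity)]
  linarith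

/-- Tail of the real part of a linear form in independent complex Gaussians. -/
lemma pi_cgaussian_re_gt {ι : Type*} [Fintype ι] {v V r : ℝ} (hv : 0 ≤ v) (hV : 0 < V)
    (hr : 0 ≤ r) (a : ι → ℂ) (ha : v * ∑ i, ‖a i‖ ^ 2 ≤ V) :
    (Measure.pi fun _ : ι => cgaussian v).real {z | r < (∑ i, a i * z i).re} ≤
      Real.exp (-(r ^ 2 / V)) := by
  -- The minimizer of the Chernoff exponent `-l r + l² V / 4`.
  set l : ℝ := 2 * r / V with hl
  have h := pi_real_lt_sum_le (μ := fun _ : ι => cgaussian v)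
    (fun i => integrable_exp_re_mul_cgaussian v (l * a i)) (l * r)
  simp only [integral_exp_re_mul_cgaussian hv] at h
  rw [← Real.exp_sum, ← Real.exp_add] at h
  rcases hr.eq_or_lt with rfl | hr
  · simp
  have hl0 : 0 < l := by positivity
  refine (measureReal_mono ?_).trans (h.trans (Real.exp_le_exp.2 ?_))
  · intro x hx
    rw [Set.mem_ofPred_eq] at hx ⊢
    have : ∀ i, ((l : ℂ) * a i * x i).re = l * (a i * x i).re := by
      intro i
      rw [mul_assoc, Complex.re_ofReal_mul]
    simp only [this]
    rw [← mul_sum, ← Complex.re_sum]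
    exact mul_lt_mul_of_pos_left hx hl0
  · have h1 : ∑ i, v * ‖(l : ℂ) * a i‖ ^ 2 / 4 = l ^ 2 / 4 * (v * ∑ i, ‖a i‖ ^ 2) := by
      rw [mul_sum, mul_sum]
      refine sum_congr rfl fun i _ => ?_
      rw [norm_mul, Complex.norm_real, Real.norm_eq_abs, mul_pow, sq_abs]
      ring
    rw [h1]
    have h2 : l ^ 2 / 4 * (v * ∑ i, ‖a i‖ ^ 2) ≤ l ^ 2 / 4 * V := by gcongr
    have h3 : -(l * r) + l ^ 2 / 4 * V = -(r ^ 2 / V) := by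
      rw [hl]; field_simp; ring
    linarith

lemma pi_cgaussian_norm_gt {ι : Type*} [Fintype ι] {v V r : ℝ} (hv : 0 ≤ v) (hV : 0 < V)
    (hr : 0 ≤ r) (a : ι → ℂ) (ha : v * ∑ i, ‖a i‖ ^ 2 ≤ V) :
    (Measure.pi fun _ : ι => cgaussian v).real {z | 2 * r < ‖∑ i, a i * z i‖} ≤
      4 * Real.exp (-(r ^ 2 / V)) := by
  set μ := Measure.pi fun _ : ι => cgaussian v
  -- Rotating by `1, -1, -i, i` presents `± re` and `± im` as real parts of linear forms with the
  -- same coefficient norms.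
  have key : ∀ c : ℂ, ‖c‖ = 1 →
      μ.real {z | r < (c * ∑ i, a i * z i).re} ≤ Real.exp (-(r ^ 2 / V)) := by
    intro c hc
    have h := pi_cgaussian_re_gt hv hV hr (fun i => c * a i) (by simpa [norm_mul, hc] using ha)
    simpa only [mul_sum, mul_assoc] using h
  have h1 := key 1 (by simp)
  have h2 := key (-1) (by simp)
  have h3 := key (-Complex.I) (by simp)
  have h4 := key Complex.I (by simp)
  have hsub : {z : ι → ℂ | 2 * r < ‖∑ i, a i * z i‖} ⊆
      ({z | r < (1 * ∑ i, a i * z i).re} ∪ {z | r < (-1 * ∑ i, a i * z i).re}) ∪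
      ({z | r < (-Complex.I * ∑ i, a i * z i).re} ∪ {z | r < (Complex.I * ∑ i, a i * z i).re}) := by
    intro z hz
    have := four_parts_of_lt_norm (Set.mem_ofPred_eq ▸ hz)
    simp only [Set.mem_union, Set.mem_ofPred_eq, one_mul, neg_mul, Complex.neg_re,
      Complex.I_mul_re, neg_neg]
    tauto
  have := (measureReal_mono (μ := μ) hsub).trans ((measureReal_union_le _ _).trans
    (add_le_add (measureReal_union_le _ _) (measureReal_union_le _ _)))
  linarith

/-! ### Deterministic bounds on the energy deviation -/

lemma abs_norm_sq_sub_norm_add_sq_le (x r : ℂ) {α : ℝ} (hα : 0 < α) :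
    |‖x‖ ^ 2 - ‖x + r‖ ^ 2| ≤ α * ‖x‖ ^ 2 + (1 / α + 1) * ‖r‖ ^ 2 := by
  have h1 : ‖x + r‖ ≤ ‖x‖ + ‖r‖ := norm_add_le x r
  have h2 : ‖x‖ ≤ ‖x + r‖ + ‖r‖ := by simpa using norm_sub_le (x + r) r
  have h3 : 2 * (‖x‖ * ‖r‖) ≤ α * ‖x‖ ^ 2 + 1 / α * ‖r‖ ^ 2 := by
    have : α * ‖x‖ ^ 2 + 1 / α * ‖r‖ ^ 2 - 2 * (‖x‖ * ‖r‖) = (α * ‖x‖ - ‖r‖) ^ 2 / α := by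
      field_simp; ring
    have h4 : 0 ≤ (α * ‖x‖ - ‖r‖) ^ 2 / α := by positivity
    linarith
  have hx := norm_nonneg x
  have hr := norm_nonneg r
  have hxr := norm_nonneg (x + r)
  rw [abs_le]
  constructor <;> nlinarith

/-- The off-diagonal part of the Gram matrix. -/
noncomputable def offGram (u s : ℕ) (B : Finset (Fin (u * s))) :
    Matrix (Fin u × Fin s) (Fin u × Fin s) ℂ :=
  gram u s B - 1

lemma conjTranspose_mulVec_mulVec (B : Finset (Fin (u * s))) (x : Fin u × Fin s → ℂ)
    (p : Fin u × Fin s) :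
    ((subFFT u s B)ᴴ *ᵥ (subFFT u s B *ᵥ x)) p = x p + ∑ q, offGram u s B p q * x q := by
  have h : gram u s B = 1 + offGram u s B := by rw [offGram, add_sub_cancel]
  rw [Matrix.mulVec_mulVec, ← gram, h, Matrix.add_mulVec, Matrix.one_mulVec]
  rfl

lemma norm_offGram_le (hn : u * s ≠ 0) {B : Finset (Fin (u * s))} (hB : #B ≠ 0) {η : ℝ}
    (hη : 0 ≤ η) (hc : Coherent η B) (p q : Fin u × Fin s) : ‖offGram u s B p q‖ ≤ η := by
  rw [offGram, Matrix.sub_apply]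
  rcases eq_or_ne p q with rfl | hpq
  · simpa [gram_diag hn hB] using hη
  · simpa [Matrix.one_apply_ne hpq] using hc p q hpq

lemma sum_norm_sq_offGram_le (hn : u * s ≠ 0) {B : Finset (Fin (u * s))} (hB : #B ≠ 0)
    (p : Fin u × Fin s) : ∑ q, ‖offGram u s B p q‖ ^ 2 ≤ ((u * s : ℕ) : ℝ) / #B := by
  rw [← sum_norm_sq_gram hn hB p]
  refine sum_le_sum fun q _ => ?_
  rw [offGram, Matrix.sub_apply]
  rcases eq_or_ne p q with rfl | hpq
  · simp [gram_diag hn hB]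
  · simp [Matrix.one_apply_ne hpq]

/-- Entrywise bound times the `ℓ¹` norm of `h`, which by Cauchy–Schwarz on the support is at most
`√(#S * 4 #S) = 2 #S`. -/
lemma norm_sum_offGram_mul_le (hn : u * s ≠ 0) {B : Finset (Fin (u * s))} (hB : #B ≠ 0) {η : ℝ}
    (hη : 0 ≤ η) (hc : Coherent η B) {S : Finset (Fin u × Fin s)} {h : Fin u × Fin s → ℂ}
    (hS : ∀ p ∉ S, h p = 0) (hh : ∑ p, ‖h p‖ ^ 2 ≤ 4 * (#S : ℝ)) (p : Fin u × Fin s) :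
    ‖∑ q, offGram u s B p q * h q‖ ≤ 2 * #S * η := by
  have h1 : ∑ q, offGram u s B p q * h q = ∑ q ∈ S, offGram u s B p q * h q := by
    refine (sum_subset (subset_univ S) fun q _ hq => ?_).symm
    rw [hS q hq, mul_zero]
  have h2 : (∑ q ∈ S, ‖h q‖) ^ 2 ≤ (2 * (#S : ℝ)) ^ 2 := by
    calc (∑ q ∈ S, ‖h q‖) ^ 2 ≤ #S * ∑ q ∈ S, ‖h q‖ ^ 2 := sq_sum_le_card_mul_sum_sq
      _ ≤ #S * ∑ q, ‖h q‖ ^ 2 := by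
          gcongr
          exact subset_univ S
      _ ≤ #S * (4 * #S) := by gcongr
      _ = _ := by ring
  have h3 : ∑ q ∈ S, ‖h q‖ ≤ 2 * #S := (sq_le_sq₀ (by positivity) (by positivity)).1 h2
  rw [h1]
  calc _ ≤ ∑ q ∈ S, ‖offGram u s B p q * h q‖ := norm_sum_le _ _
    _ ≤ ∑ q ∈ S, η * ‖h q‖ := by
        refine sum_le_sum fun q _ => ?_
        rw [norm_mul]
        gcongr
        exact norm_offGram_le hn hB hη hc p q
    _ = η * ∑ q ∈ S, ‖h q‖ := by rw [mul_sum]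
    _ ≤ η * (2 * #S) := by gcongr
    _ = _ := by ring

lemma not_deviates_of_bounds {ks k : ℕ} {ε ρ : ℝ} (hε : 0 < ε) (hk : 1 ≤ k)
    (hρ : 1024 * (1 + ε) ^ 2 * k * ks * ρ ^ 2 ≤ ε ^ 2) (B : Finset (Fin (u * s)))
    {h z : Fin u × Fin s → ℂ} (hh : ∑ p, ‖h p‖ ^ 2 ≤ 4 * (k : ℝ)) (hz : ∑ p, ‖z p‖ ^ 2 ≤ 4)
    (hEh : ∀ p, ‖∑ q, offGram u s B p q * h q‖ ≤ ρ)
    (hEz : ∀ p, ‖∑ q, offGram u s B p q * z q‖ ≤ ρ) : ¬ Deviates ks ε B (h + z) := by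
  rintro ⟨i, ω, hω, hlt⟩
  have hk0 : (1 : ℝ) ≤ k := by exact_mod_cast hk
  refine absurd hlt (not_lt.2 ?_)
  -- The energy of `h + z` is at most `2 * 4k + 2 * 4 ≤ 16k`, so this weight spends exactly `ε / 2`
  -- on it and leaves `ε / 2` for the residual `r = E (h + z)`.
  set α : ℝ := ε / (32 * k) with hα
  have hα0 : 0 < α := by positivity
  set r : Fin u × Fin s → ℂ := fun p => ∑ q, offGram u s B p q * (h + z) q with hr
  have hrp : ∀ p, ‖r p‖ ^ 2 ≤ 4 * ρ ^ 2 := by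
    intro p
    have h1 : r p = ∑ q, offGram u s B p q * h q + ∑ q, offGram u s B p q * z q := by
      simp only [hr, Pi.add_apply, mul_add, sum_add_distrib]
    have h2 : ‖r p‖ ≤ 2 * ρ := by
      rw [h1]
      exact (norm_add_le _ _).trans (by linarith [hEh p, hEz p])
    calc ‖r p‖ ^ 2 ≤ (2 * ρ) ^ 2 := by gcongr
      _ = _ := by ring
  have hx : ∑ j ∈ ω, ‖(h + z) (i, j)‖ ^ 2 ≤ 16 * k := by
    calc ∑ j ∈ ω, ‖(h + z) (i, j)‖ ^ 2
        ≤ ∑ j, ‖(h + z) (i, j)‖ ^ 2 :=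
          sum_le_sum_of_subset_of_nonneg (subset_univ ω) fun _ _ _ => by positivity
      _ ≤ ∑ i, ∑ j, ‖(h + z) (i, j)‖ ^ 2 :=
          single_le_sum (f := fun i => ∑ j, ‖(h + z) (i, j)‖ ^ 2)
            (fun i _ => sum_nonneg fun _ _ => by positivity) (mem_univ i)
      _ = ∑ p, ‖(h + z) p‖ ^ 2 := (Fintype.sum_prod_type fun p => ‖(h + z) p‖ ^ 2).symm
      _ ≤ ∑ p, (2 * ‖h p‖ ^ 2 + 2 * ‖z p‖ ^ 2) := by
          refine sum_le_sum fun p _ => ?_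
          have h1 : ‖(h + z) p‖ ^ 2 ≤ (‖h p‖ + ‖z p‖) ^ 2 := by
            gcongr
            exact norm_add_le _ _
          nlinarith [sq_nonneg (‖h p‖ - ‖z p‖)]
      _ = 2 * ∑ p, ‖h p‖ ^ 2 + 2 * ∑ p, ‖z p‖ ^ 2 := by
          rw [sum_add_distrib, mul_sum, mul_sum]
      _ ≤ 16 * k := by linarith
  have hrω : ∑ j ∈ ω, ‖r (i, j)‖ ^ 2 ≤ ks * (4 * ρ ^ 2) := by
    calc _ ≤ ∑ j ∈ ω, 4 * ρ ^ 2 := sum_le_sum fun j _ => hrp _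
      _ = _ := by rw [sum_const, hω, nsmul_eq_mul]
  -- The factor `(1 + ε)²` makes this at most both `ε² / 256`, needed for the coefficient `1 / α`,
  -- and `ε / 256`, needed for the coefficient 1 when `ε` is large.
  have hkR : k * (ks * (4 * ρ ^ 2)) ≤ ε ^ 2 / (256 * (1 + ε) ^ 2) := by
    rw [le_div_iff₀ (by positivity)]
    linarith
  have hR0 : 0 ≤ ks * (4 * ρ ^ 2) := by positivity
  have h1 : ε ^ 2 / (256 * (1 + ε) ^ 2) ≤ ε ^ 2 / 256 := by
    gcongr
    nlinarith
  have h2 : ε ^ 2 / (256 * (1 + ε) ^ 2) ≤ ε / 256 := by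
    rw [div_le_div_iff₀ (by positivity) (by norm_num)]
    nlinarith [pow_pos hε 2, pow_pos hε 3]
  have h3 : (1 / α + 1) * (ks * (4 * ρ ^ 2)) ≤ ε / 2 := by
    have h4 : 1 / α * (ks * (4 * ρ ^ 2)) = 32 / ε * (k * (ks * (4 * ρ ^ 2))) := by
      rw [hα]; field_simp
    have h5 : 32 / ε * (k * (ks * (4 * ρ ^ 2))) ≤ 32 / ε * (ε ^ 2 / 256) := by
      gcongr
      exact hkR.trans h1
    have h6 : 32 / ε * (ε ^ 2 / 256) = ε / 8 := by field_simp; norm_num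
    have h7 : ks * (4 * ρ ^ 2) ≤ k * (ks * (4 * ρ ^ 2)) := le_mul_of_one_le_left hR0 hk0
    linarith
  have h4 : α * (16 * k) = ε / 2 := by rw [hα]; field_simp; norm_num
  rw [← sum_sub_distrib]
  calc _ ≤ ∑ j ∈ ω, |‖(h + z) (i, j)‖ ^ 2 -
        ‖((subFFT u s B)ᴴ *ᵥ (subFFT u s B *ᵥ (h + z))) (i, j)‖ ^ 2| := abs_sum_le_sum_abs _ _
    _ ≤ ∑ j ∈ ω, (α * ‖(h + z) (i, j)‖ ^ 2 + (1 / α + 1) * ‖r (i, j)‖ ^ 2) := by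
        refine sum_le_sum fun j _ => ?_
        rw [conjTranspose_mulVec_mulVec]
        exact abs_norm_sq_sub_norm_add_sq_le _ _ hα0
    _ = α * ∑ j ∈ ω, ‖(h + z) (i, j)‖ ^ 2 + (1 / α + 1) * ∑ j ∈ ω, ‖r (i, j)‖ ^ 2 := by
        rw [sum_add_distrib, mul_sum, mul_sum]
    _ ≤ α * (16 * k) + (1 / α + 1) * (ks * (4 * ρ ^ 2)) := by gcongr
    _ ≤ ε := by linarith

/-! ### Probability bounds for fixed and random row sets -/

/-- The deviation probability given the support and a row set of small coherence. -/
lemma prod_real_deviates_le {ks m : ℕ} {ε ρ snr : ℝ} (hn : u * s ≠ 0)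
    {B : Finset (Fin (u * s))} (hB : #B = m) (hm : m ≠ 0) (hsnr : 1 ≤ snr) (hε : 0 < ε)
    (hρ0 : 0 ≤ ρ) {S : Finset (Fin u × Fin s)} (hS : 1 ≤ #S)
    (hρ : 1024 * (1 + ε) ^ 2 * #S * ks * ρ ^ 2 ≤ ε ^ 2) (hc : Coherent (ρ / (2 * #S)) B) :
    ((signalLaw S).prod (noiseLaw u s m snr)).real {q | Deviates ks ε B (q.1 + q.2)} ≤
      2 * Real.exp (-#S) + 4 * (u * s : ℕ) * Real.exp (-(ρ ^ 2 * (u * s : ℕ) / 4)) := by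
  have hn0 : (0 : ℝ) < ((u * s : ℕ) : ℝ) := by exact_mod_cast Nat.pos_of_ne_zero hn
  have hm0 : (0 : ℝ) < m := by exact_mod_cast Nat.pos_of_ne_zero hm
  have hcard : (Fintype.card (Fin u × Fin s) : ℝ) = ((u * s : ℕ) : ℝ) := by simp
  have hSn : (#S : ℝ) ≤ ((u * s : ℕ) : ℝ) := by
    rw [← hcard]
    exact_mod_cast card_le_univ S
  have hmn : (m : ℝ) ≤ ((u * s : ℕ) : ℝ) := by
    have := card_le_univ B
    rw [hB, Fintype.card_fin] at this
    exact_mod_cast this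
  have hB0 : #B ≠ 0 := hB ▸ hm
  have hS0 : (0 : ℝ) < #S := by exact_mod_cast hS
  have hrow (p : Fin u × Fin s) := sum_norm_sq_offGram_le hn hB0 p
  simp only [hB] at hrow
  set n : ℝ := ((u * s : ℕ) : ℝ)
  set v : ℝ := (1 / snr) * m / n ^ 2 with hv
  have hsnr0 : 0 < snr := by linarith
  have hv0 : 0 < v := by positivity
  have hsnr1 : 1 / snr ≤ 1 := by rw [div_le_one hsnr0]; exact hsnr
  have hnv : n * v ≤ 1 := by
    have : n * v = 1 / snr * (m / n) := by rw [hv]; field_simp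
    rw [this]
    exact mul_le_one₀ hsnr1 (by positivity) ((div_le_one hn0).2 hmn)
  have hvE : ∀ p, v * ∑ q, ‖offGram u s B p q‖ ^ 2 ≤ 1 / n := by
    intro p
    calc v * ∑ q, ‖offGram u s B p q‖ ^ 2 ≤ v * (n / m) := by
          gcongr
          exact hrow p
      _ = 1 / snr * (1 / n) := by rw [hv]; field_simp
      _ ≤ 1 / n := mul_le_of_le_one_left (by positivity) hsnr1
  let H₁ : Set (Fin u × Fin s → ℂ) := {h | 4 * (#S : ℝ) < ∑ p, ‖h p‖ ^ 2}
  let H₂ : Set (Fin u × Fin s → ℂ) := {h | ∃ p ∉ S, h p ≠ 0}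
  let Z₁ : Set (Fin u × Fin s → ℂ) :=
    {z | 4 * (Fintype.card (Fin u × Fin s) * v) < ∑ p, ‖z p‖ ^ 2}
  let Z₂ (p : Fin u × Fin s) : Set (Fin u × Fin s → ℂ) :=
    {z | 2 * (ρ / 2) < ‖∑ q, offGram u s B p q * z q‖}
  -- Each covering rectangle constrains only the signal or only the noise, so its measure is a
  -- marginal probability.
  have hsub : {q : (Fin u × Fin s → ℂ) × (Fin u × Fin s → ℂ) | Deviates ks ε B (q.1 + q.2)} ⊆
      (H₁ ∪ H₂) ×ˢ Set.univ ∪ Set.univ ×ˢ (Z₁ ∪ ⋃ p ∈ (univ : Finset (Fin u × Fin s)), Z₂ p) := by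
    rintro ⟨h, z⟩ hq
    by_contra hnot
    simp only [Set.mem_union, Set.mem_prod, Set.mem_univ, and_true, true_and, Set.mem_iUnion,
      not_or, not_exists] at hnot
    obtain ⟨⟨hh1, hh2⟩, hz1, hz2⟩ := hnot
    have hh1 : ∑ p, ‖h p‖ ^ 2 ≤ 4 * (#S : ℝ) := not_lt.1 hh1
    have hh2 : ∀ p ∉ S, h p = 0 := fun p hp => by_contra fun hne => hh2 ⟨p, hp, hne⟩
    have hz1 : ∑ p, ‖z p‖ ^ 2 ≤ 4 * (Fintype.card (Fin u × Fin s) * v) := not_lt.1 hz1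
    refine not_deviates_of_bounds hε hS hρ B hh1 (hz1.trans ?_) (fun p => ?_) (fun p => ?_) hq
    · rw [hcard]; linarith
    · refine (norm_sum_offGram_mul_le hn hB0 (by positivity) hc hh2 hh1 p).trans (le_of_eq ?_)
      field_simp
    · have : ‖∑ q, offGram u s B p q * z q‖ ≤ 2 * (ρ / 2) := not_lt.1 (hz2 p (mem_univ p))
      linarith
  have hH : (signalLaw S).real (H₁ ∪ H₂) ≤ Real.exp (-#S) :=
    (measureReal_union_le _ _).trans
      ((add_le_add (signalLaw_norm_sq S) (signalLaw_support S).le).trans (by simp))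
  have hZ1 : (noiseLaw u s m snr).real Z₁ ≤ Real.exp (-#S) := by
    refine (pi_cgaussian_norm_sq hv0).trans ?_
    rw [hcard]
    gcongr
  have hZ2 : ∀ p, (noiseLaw u s m snr).real (Z₂ p) ≤ 4 * Real.exp (-(ρ ^ 2 * n / 4)) := by
    intro p
    refine (pi_cgaussian_norm_gt hv0.le (V := 1 / n) (by positivity) (by positivity)
      (offGram u s B p) (hvE p)).trans (le_of_eq ?_)
    congr 3
    field_simp
    norm_num
  have hZ : (noiseLaw u s m snr).real (Z₁ ∪ ⋃ p ∈ (univ : Finset (Fin u × Fin s)), Z₂ p) ≤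
      Real.exp (-#S) + n * (4 * Real.exp (-(ρ ^ 2 * n / 4))) := by
    refine (measureReal_union_le _ _).trans (add_le_add hZ1 ?_)
    refine (measureReal_biUnion_finset_le _ _).trans ((sum_le_sum fun p _ => hZ2 p).trans ?_)
    rw [sum_const, card_univ, nsmul_eq_mul, hcard]
  refine (measureReal_mono hsub (by finiteness)).trans ((measureReal_union_le _ _).trans ?_)
  rw [measureReal_prod_prod, measureReal_prod_prod, probReal_univ, probReal_univ, mul_one, one_mul]
  linarith

lemma card_of_mem_hierSupports {ku ks : ℕ} {S : Finset (Fin u × Fin s)}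
    (hS : S ∈ hierSupports u s ku ks) : #S = ku * ks := by
  obtain ⟨-, h1, h2⟩ := mem_filter.1 hS
  rw [card_eq_sum_card_image Prod.fst S, sum_congr rfl h2, sum_const, h1, smul_eq_mul]

lemma failProb_le_one (u s ku ks m : ℕ) (snr ε : ℝ) : failProb u s ku ks m snr ε ≤ 1 := by
  refine div_le_one_of_le₀ ?_ (by positivity)
  calc _ ≤ ∑ B ∈ powersetCard m (univ : Finset (Fin (u * s))), ∑ S ∈ hierSupports u s ku ks,
        (1 : ℝ) := sum_le_sum fun _ _ => sum_le_sum fun _ _ => measureReal_le_one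
    _ = _ := by simp

/-- Averaging over the row set: either its coherence is large, or it is small and the deviation
probability is bounded uniformly. -/
lemma failProb_le_of_coherent {ku ks m : ℕ} {snr ε η b q : ℝ} (hb : 0 ≤ b) (hq : 0 ≤ q)
    (hbad : ∀ [DecidablePred fun B : Finset (Fin (u * s)) => ¬ Coherent η B],
      (#{B ∈ powersetCard m (univ : Finset (Fin (u * s))) | ¬ Coherent η B} : ℝ) ≤
        #(powersetCard m (univ : Finset (Fin (u * s)))) * b)
    (hgood : ∀ B : Finset (Fin (u * s)), #B = m → Coherent η B → ∀ S ∈ hierSupports u s ku ks,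
      ((signalLaw S).prod (noiseLaw u s m snr)).real {q | Deviates ks ε B (q.1 + q.2)} ≤ q) :
    failProb u s ku ks m snr ε ≤ b + q := by
  classical
  refine div_le_of_le_mul₀ (by positivity) (by positivity) ?_
  set P := powersetCard m (univ : Finset (Fin (u * s)))
  set T := hierSupports u s ku ks
  calc _ ≤ ∑ B ∈ P, ∑ S ∈ T, ((if ¬ Coherent η B then 1 else 0) + q) := by
        refine sum_le_sum fun B hB => sum_le_sum fun S hS => ?_
        by_cases h : Coherent η B
        · rw [if_neg (not_not.2 h), zero_add]
          exact hgood B (mem_powersetCard.1 hB).2 h S hS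
        · rw [if_pos h]
          exact measureReal_le_one.trans (by linarith)
    _ = #T * (#{B ∈ P | ¬ Coherent η B} : ℝ) + #P * (#T * q) := by
        simp only [sum_const, nsmul_eq_mul, ← mul_sum, sum_add_distrib, mul_add, sum_boole]
    _ ≤ #T * (#P * b) + #P * (#T * q) := by gcongr; exact hbad
    _ = _ := by ring

/-- The failure probability is at most `32 n exp(-X) + 4 exp(-k / 2)` with `k = ku ks`, `n = u s`
and `X` proportional to `ε² m / (k⁴ ks)`. -/
lemma failProb_le {ε₀ ε snr : ℝ} {u s ku ks m : ℕ} (hε : 0 < ε) (hε₀ : ε ≤ ε₀)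
    (hadm : Admissible u s ku ks m) (hsnr : 1 ≤ snr) :
    failProb u s ku ks m snr ε ≤
      32 * (u * s : ℕ) * Real.exp (-(ε ^ 2 * m /
        (65536 * (1 + ε₀) ^ 2 * (4 * (ku : ℝ) ^ 4 * (ks : ℝ) ^ 5)))) +
      4 * Real.exp (-((ku : ℝ) * ks / 2)) := by
  obtain ⟨hku, hkuu, hks, hkss, hm, hmn⟩ := hadm
  have hn : u * s ≠ 0 := by omega
  set n : ℕ := u * s
  have hku0 : (1 : ℝ) ≤ ku := by exact_mod_cast (by omega : 1 ≤ ku)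
  have hks0 : (1 : ℝ) ≤ ks := by exact_mod_cast (by omega : 1 ≤ ks)
  have hm0 : (1 : ℝ) ≤ m := by exact_mod_cast hm
  have hn0 : (1 : ℝ) ≤ n := by exact_mod_cast Nat.pos_of_ne_zero hn
  have hmn' : (m : ℝ) ≤ n := by exact_mod_cast hmn
  have hk1 : 1 ≤ ku * ks := Nat.mul_pos (by omega) (by omega)
  set k : ℝ := (ku : ℝ) * ks with hk
  have hk0 : 1 ≤ k := one_le_mul_of_one_le_of_one_le hku0 hks0
  set X : ℝ := ε ^ 2 * m / (65536 * (1 + ε₀) ^ 2 * (4 * (ku : ℝ) ^ 4 * (ks : ℝ) ^ 5)) with hX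
  have hε₀' : 0 < ε₀ := hε.trans_le hε₀
  have hX0 : 0 ≤ X := by positivity
  have hexp0 := Real.exp_pos (-(k / 2))
  -- If `exp X < n`, the claimed bound exceeds 1. Otherwise `n ≤ exp X`, and surplus powers of `n`
  -- can be absorbed into the exponential.
  rcases lt_or_ge (Real.exp X) n with hnX | hnX
  · have h1 : 1 ≤ n * Real.exp (-X) := by
      rw [Real.exp_neg, ← div_eq_mul_inv, one_le_div (Real.exp_pos _)]
      exact hnX.le
    have := failProb_le_one u s ku ks m snr ε
    linarith
  -- Chosen so that `1024 (1 + ε₀)² k ks ρ² = ε²`, the budget of `not_deviates_of_bounds`.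
  set ρ : ℝ := ε / (32 * (1 + ε₀) * Real.sqrt (k * ks)) with hρ
  have hkks : 1 ≤ k * ks := one_le_mul_of_one_le_of_one_le hk0 hks0
  have hρ0 : 0 ≤ ρ := by positivity
  have hρsq : ρ ^ 2 = ε ^ 2 / (1024 * (1 + ε₀) ^ 2 * (k * ks)) := by
    rw [hρ, div_pow, mul_pow, mul_pow, Real.sq_sqrt (by positivity)]
    norm_num
  have hρ1 : ρ ≤ 1 := by
    rw [hρ, div_le_one (by positivity)]
    have : 1 ≤ Real.sqrt (k * ks) := Real.one_le_sqrt.2 hkks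
    nlinarith
  set η : ℝ := ρ / (2 * k) with hη
  have hη0 : 0 ≤ η := by positivity
  have hη1 : η ≤ 1 := by
    rw [hη, div_le_one (by positivity)]
    linarith
  -- Here `65536 = 16 * 4 * 1024` and `ku⁴ ks⁵ = k⁴ ks`, while `η²` has only `k³ ks` in its
  -- denominator; hence the spare factor `k`.
  have hmη : m * η ^ 2 / 16 = 4 * k * X := by
    rw [hη, div_pow, hρsq, hX, hk]
    field_simp
    norm_num
  have h4X : 4 * X ≤ m * η ^ 2 / 16 := by
    rw [hmη]
    nlinarith
  have h4X' : 4 * X ≤ ρ ^ 2 * n / 4 := by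
    refine h4X.trans ?_
    have h1 : η ≤ ρ := by
      rw [hη]
      exact div_le_self hρ0 (by linarith)
    have h2 : m * η ^ 2 ≤ n * ρ ^ 2 := by gcongr
    have h3 : 0 ≤ n * ρ ^ 2 := by positivity
    linarith
  have hb := failProb_le_of_coherent (u := u) (s := s) (ku := ku) (ks := ks) (m := m)
    (snr := snr) (ε := ε) (η := η)
    (b := 4 * (n : ℝ) ^ 2 * Real.exp (-(m * η ^ 2 / 16)))
    (q := 2 * Real.exp (-k) + 4 * n * Real.exp (-(ρ ^ 2 * n / 4)))
    (by positivity) (by positivity)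
    (by
      intro _
      convert card_not_coherent_le hn (by omega : m ≠ 0) hη0 hη1)
    (by
      intro B hB hc S hS
      have hSk := card_of_mem_hierSupports hS
      have hSk' : (#S : ℝ) = k := by rw [hSk, hk]; push_cast; rfl
      have := prod_real_deviates_le (ks := ks) hn hB (by omega) hsnr hε hρ0 (S := S) (by omega)
        (by
          rw [hSk', hρsq]
          calc 1024 * (1 + ε) ^ 2 * k * ks * (ε ^ 2 / (1024 * (1 + ε₀) ^ 2 * (k * ks)))
              = ((1 + ε) / (1 + ε₀)) ^ 2 * ε ^ 2 := by field_simp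
            _ ≤ 1 * ε ^ 2 := by
                gcongr
                exact pow_le_one₀ (by positivity) ((div_le_one (by positivity)).2 (by linarith))
            _ = ε ^ 2 := one_mul _)
        (by rwa [hSk'])
      rwa [hSk'] at this)
  have hY : Real.exp (-(4 * X)) ≤ Real.exp (-X) * (Real.exp X)⁻¹ := by
    rw [← Real.exp_neg, ← Real.exp_add]
    exact Real.exp_le_exp.2 (by linarith)
  have hnY : n * Real.exp (-(4 * X)) ≤ Real.exp (-X) := by
    calc n * Real.exp (-(4 * X)) ≤ Real.exp X * (Real.exp (-X) * (Real.exp X)⁻¹) := by gcongr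
      _ = Real.exp (-X) := by field_simp
  have h1 : 4 * (n : ℝ) ^ 2 * Real.exp (-(m * η ^ 2 / 16)) ≤ 4 * n * Real.exp (-X) := by
    calc _ ≤ 4 * (n : ℝ) ^ 2 * Real.exp (-(4 * X)) := by gcongr
      _ = 4 * n * (n * Real.exp (-(4 * X))) := by ring
      _ ≤ _ := by gcongr
  have h2 : 4 * n * Real.exp (-(ρ ^ 2 * n / 4)) ≤ 4 * n * Real.exp (-X) := by
    gcongr
    linarith
  have h3 : Real.exp (-k) ≤ Real.exp (-(k / 2)) := Real.exp_le_exp.2 (by linarith)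
  have h4 : 0 ≤ n * Real.exp (-X) := by positivity
  linarith

/-! ### The stated bound and its limit -/

/-- Write `n = u (s / ks) ks`; the base `e s / ks` is at least 1, so raising it to the power `ks`
only increases it. -/
lemma mul_le_union_bound_count {u s ks : ℕ} (hks : 1 ≤ ks) (hkss : ks ≤ s) :
    ((u * s : ℕ) : ℝ) ≤ u * (Real.exp 1 * s / ks) ^ ks * ks := by
  have hks0 : (0 : ℝ) < ks := by exact_mod_cast hks
  have hs : (ks : ℝ) ≤ s := by exact_mod_cast hkss
  have he : 1 ≤ Real.exp 1 := Real.one_le_exp (by norm_num)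
  have h1 : 1 ≤ Real.exp 1 * s / ks := by
    rw [one_le_div hks0]
    nlinarith
  have h2 : s / ks ≤ (Real.exp 1 * s / ks) ^ ks := by
    refine le_trans ?_ (le_self_pow₀ h1 (by omega))
    gcongr
    exact le_mul_of_one_le_left (by positivity) he
  calc ((u * s : ℕ) : ℝ) = u * (s / ks) * ks := by push_cast; field_simp
    _ ≤ _ := by gcongr

end HierSparse

open HierSparse
theorem lemma1 :
    (∀ ε₀ : ℝ, 0 < ε₀ → ∃ C : ℝ, 0 < C ∧ ∃ snr₀ : ℝ, 0 < snr₀ ∧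
      ∀ (ε : ℝ) (u s ku ks m : ℕ) (snr : ℝ), 0 < ε → ε ≤ ε₀ →
        HierSparse.Admissible u s ku ks m → snr₀ ≤ snr →
        HierSparse.failProb u s ku ks m snr ε ≤
          32 * u * (Real.exp 1 * s / ks) ^ ks * ks *
              Real.exp (-(ε ^ 2 * m / (C * (4 * (ku : ℝ) ^ 4 * (ks : ℝ) ^ 5))))
            + 32 * ks / Real.sqrt 2 * ((snr ^ (ku * ks))⁻¹ / ((u * s : ℕ) : ℝ) ^ (2 * ks)) *
              ((ku : ℝ) ^ 4 * (ks : ℝ) ^ 5 /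
                ((u * s : ℕ) : ℝ) ^ (1 - 3 / (ku : ℝ))) ^ (ku * ks)
            + 4 * Real.exp (-((ku : ℝ) * ks / 2))) ∧
    (∀ ε : ℝ, 0 < ε → ∃ K : ℝ, 0 < K ∧ ∃ snr₀ : ℝ, 0 < snr₀ ∧
      ∀ (u s ku ks m : ℕ → ℕ) (snr : ℕ → ℝ),
        (∀ t, HierSparse.Admissible (u t) (s t) (ku t) (ks t) (m t)) →
        (∀ t, snr₀ ≤ snr t) →
        Tendsto (fun t => ku t * ks t) atTop atTop →
        Tendsto (fun t => (ku t : ℝ) ^ 4 * (ks t : ℝ) ^ 5 /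
          ((u t * s t : ℕ) : ℝ) ^ (1 - 3 / (ku t : ℝ))) atTop (𝓝 0) →
        (∀ t, K * ((ku t : ℝ) ^ 4 * (ks t : ℝ) ^ 6 * Real.log ((u t * s t : ℕ) : ℝ)) ≤ m t) →
        Tendsto (fun t => HierSparse.failProb (u t) (s t) (ku t) (ks t) (m t) (snr t) ε)
          atTop (𝓝 0)) := by
  refine ⟨fun ε₀ hε₀ => ⟨65536 * (1 + ε₀) ^ 2, by positivity, 1, one_pos, ?_⟩,
    -- This `K` forces the exponent of `failProb_le`, taken with `ε₀ = ε`, to be at least `2 log n`.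
    -- The leading term is then at most `32 / n ≤ 32 / k`.
    fun ε hε => ⟨2 * (65536 * (1 + ε) ^ 2 * 4) / ε ^ 2, by positivity, 1, one_pos, ?_⟩⟩
  · intro ε u s ku ks m snr hε hεε₀ hadm hsnr
    have h := failProb_le hε hεε₀ hadm hsnr
    obtain ⟨hku, hkuu, hks, hkss, hm, hmn⟩ := hadm
    have hcount := mul_le_union_bound_count (u := u) (by omega : 1 ≤ ks) hkss
    have h2 : 0 ≤ 32 * ks / Real.sqrt 2 * ((snr ^ (ku * ks))⁻¹ / ((u * s : ℕ) : ℝ) ^ (2 * ks)) *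
        ((ku : ℝ) ^ 4 * (ks : ℝ) ^ 5 / ((u * s : ℕ) : ℝ) ^ (1 - 3 / (ku : ℝ))) ^ (ku * ks) := by
      have : 0 < snr := by linarith
      positivity
    have h3 := mul_le_mul_of_nonneg_right hcount (Real.exp_pos (-(ε ^ 2 * m /
      (65536 * (1 + ε₀) ^ 2 * (4 * (ku : ℝ) ^ 4 * (ks : ℝ) ^ 5))))).le
    linarith
  · intro u s ku ks m snr hadm hsnr hk _ hm
    have hk' : Tendsto (fun t => (ku t : ℝ) * ks t) atTop atTop := by
      have := tendsto_natCast_atTop_atTop (R := ℝ) |>.comp hk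
      simpa [Function.comp_def] using this
    have hlim : Tendsto (fun t => 32 * ((ku t : ℝ) * ks t)⁻¹ +
        4 * Real.exp (-((ku t : ℝ) * ks t / 2))) atTop (𝓝 0) := by
      have h1 := (tendsto_inv_atTop_zero.comp hk').const_mul (32 : ℝ)
      have h2 := (Real.tendsto_exp_neg_atTop_nhds_zero.comp
        (hk'.atTop_div_const (two_pos))).const_mul (4 : ℝ)
      simpa using h1.add h2
    refine squeeze_zero (fun t => ?_) (fun t => ?_) hlim
    · exact div_nonneg (sum_nonneg fun _ _ => sum_nonneg fun _ _ => measureReal_nonneg)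
        (by positivity)
    · refine (failProb_le hε le_rfl (hadm t) (hsnr t)).trans ?_
      gcongr ?_ + _
      obtain ⟨hku, hkuu, hks, hkss, -, -⟩ := hadm t
      have hmt := hm t
      have hku0 : (1 : ℝ) ≤ ku t := by exact_mod_cast (by omega : 1 ≤ ku t)
      have hks0 : (1 : ℝ) ≤ ks t := by exact_mod_cast (by omega : 1 ≤ ks t)
      have hkn : (ku t : ℝ) * ks t ≤ (u t * s t : ℕ) := by
        exact_mod_cast Nat.mul_le_mul hkuu hkss
      generalize ((u t * s t : ℕ) : ℝ) = n at *
      have hk0 : 1 ≤ (ku t : ℝ) * ks t := one_le_mul_of_one_le_of_one_le hku0 hks0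
      have hn1 : 1 ≤ n := hk0.trans hkn
      have hlog : 0 ≤ Real.log n := Real.log_nonneg hn1
      have hX : 2 * Real.log n ≤ ε ^ 2 * m t /
          (65536 * (1 + ε) ^ 2 * (4 * (ku t : ℝ) ^ 4 * (ks t : ℝ) ^ 5)) := by
        rw [le_div_iff₀ (by positivity)]
        have h1 := mul_le_mul_of_nonneg_left hmt (sq_nonneg ε)
        refine le_trans ?_ h1
        calc _ = 2 * (65536 * (1 + ε) ^ 2 * 4) * ((ku t : ℝ) ^ 4 * (ks t : ℝ) ^ 5 * Real.log n) := by
              ring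
          _ ≤ 2 * (65536 * (1 + ε) ^ 2 * 4) * ((ku t : ℝ) ^ 4 * (ks t : ℝ) ^ 6 * Real.log n) := by
              gcongr
              norm_num
          _ = _ := by field_simp
      have hexp : n * Real.exp (-(2 * Real.log n)) = n⁻¹ := by
        rw [Real.exp_neg, two_mul, Real.exp_add, Real.exp_log (by linarith)]
        field_simp
      calc _ ≤ 32 * n * Real.exp (-(2 * Real.log n)) := by gcongr
        _ = 32 * n⁻¹ := by rw [mul_assoc, hexp]
        _ ≤ _ := by gcongr
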